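/- An orthogonal category $\overline{\mathbf{C}} = (\mathbf{C},\perp)$ is a small category $\mathbf{C}$ together with a relation $\perp$ on pairs of morphisms with a common target such that $f_1\perp f_2$ implies $f_2\perp f_1$, and $f_1\perp f_2$ implies $(g\,f_1\,h_1)\perp(g\,f_2\,h_2)$ for all composable morphisms $g,h_1,h_2$ of $\mathbf{C}$. Let $(\mathbf{M},\otimes,I)$ be a closed symmetric monoidal category in which all small limits and colimits exist, and let $\mathbf{Alg}_{\mathsf{As}}(\mathbf{M})$ be the category of associative and unital algebras (monoid objects) in $\mathbf{M}$. An $\mathbf{M}$-valued AQFT on $\overline{\mathbf{C}}$ is a functor $\mathfrak{A}:\mathbf{C}\to\mathbf{Alg}_{\mathsf{As}}(\mathbf{M})$ such that, for all $f_1:c_1\to c$ and $f_2:c_2\to c$ with $f_1\perp f_2$, $$\mu_c\circ\big(\mathfrak{A}(f_1)\otimes\mathfrak{A}(f_2)\big)=\mu_c^{\mathrm{op}}\circ\big(\mathfrak{A}(f_1)\otimes\mathfrak{A}(f_2)\big)$$ as morphisms $\mathfrak{A}(c_1)\otimes\mathfrak{A}(c_2)\to\mathfrak{A}(c)$ in $\mathbf{M}$,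 where $\mu_c$ is the multiplication of $\mathfrak{A}(c)$ and $\mu_c^{\mathrm{op}}$ is its composite with the symmetry of $\mathbf{M}$. Let $\mathbf{QFT}(\overline{\mathbf{C}})$ be the full subcategory of the functor category $\mathbf{Alg}_{\mathsf{As}}(\mathbf{M})^{\mathbf{C}}$ on the $\mathbf{M}$-valued AQFTs. Proposition 2.7. For every orthogonal category $\overline{\mathbf{C}}$ and every closed symmetric monoidal category $\mathbf{M}$ with all small limits and colimits, the category $\mathbf{QFT}(\overline{\mathbf{C}})$ of $\mathbf{M}$-valued AQFTs on $\overline{\mathbf{C}}$ has all small limits and all small colimits. -/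

import Mathlib

open CategoryTheory MonoidalCategory Limits

universe w v u

/-- An orthogonality relation on a category `C`: a symmetric relation on pairs of morphisms with a
common target that is stable under postcomposition (with a common morphism) and precomposition. An
orthogonal category is a small category together with an orthogonality relation. -/
structure OrthogonalityRelation (C : Type w) [SmallCategory C] where
  /-- `Perp f₁ f₂` means that `f₁` and `f₂` are orthogonal. -/
  Perp : ∀ {c₁ c₂ c : C}, (c₁ ⟶ c) → (c₂ ⟶ c) → Prop
  symm : ∀ {c₁ c₂ c : C} {f₁ : c₁ ⟶ c} {f₂ : c₂ ⟶ c}, Perp f₁ f₂ → Perp f₂ f₁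
  comp_stable : ∀ {b₁ b₂ c₁ c₂ c d : C} {f₁ : c₁ ⟶ c} {f₂ : c₂ ⟶ c}
    (g : c ⟶ d) (h₁ : b₁ ⟶ c₁) (h₂ : b₂ ⟶ c₂),
    Perp f₁ f₂ → Perp (h₁ ≫ f₁ ≫ g) (h₂ ≫ f₂ ≫ g)

/-- The property of a functor `𝔄 : C ⥤ Mon M` to the associative and unital algebras (monoid
objects) in `M` that, for all `f₁ : c₁ ⟶ c` and `f₂ : c₂ ⟶ c` with `f₁ ⊥ f₂`, the multiplication
and the opposite multiplication of `𝔄 c` agree after `𝔄 f₁ ⊗ 𝔄 f₂ : 𝔄 c₁ ⊗ 𝔄 c₂ ⟶ 𝔄 c ⊗ 𝔄 c`. -/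
def IsPerpCommutative {C : Type w} [SmallCategory C] (O : OrthogonalityRelation C)
    (M : Type u) [Category.{v} M] [MonoidalCategory M] [SymmetricCategory M] :
    ObjectProperty (C ⥤ Mon M) :=
  fun 𝔄 => ∀ ⦃c₁ c₂ c : C⦄ (f₁ : c₁ ⟶ c) (f₂ : c₂ ⟶ c), O.Perp f₁ f₂ →
    ((𝔄.map f₁).hom ⊗ₘ (𝔄.map f₂).hom) ≫ MonObj.mul (X := (𝔄.obj c).X) =
      ((𝔄.map f₁).hom ⊗ₘ (𝔄.map f₂).hom) ≫
        (β_ (𝔄.obj c).X (𝔄.obj c).X).hom ≫ MonObj.mul (X := (𝔄.obj c).X)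

/-- The category of `M`-valued algebraic quantum field theories on the orthogonal category `(C, O)`:
the full subcategory of the functor category `C ⥤ Mon M` on the `⊥`-commutative functors. -/
abbrev QFT {C : Type w} [SmallCategory C] (O : OrthogonalityRelation C)
    (M : Type u) [Category.{v} M] [MonoidalCategory M] [SymmetricCategory M] :=
  (IsPerpCommutative O M).FullSubcategory

/-
Limits: in a limit of monoids the projections are jointly monic and reflect commutation relations,
so `⊥`-commutative functors are closed under limits.

Colimits: the two-sided congruence generated by a pair of morphisms `r s : X ⟶ A` into a monoid is
the coequalizer of the bimodule maps `a ⊗ x ⊗ b ↦ a * r x * b` and `a ⊗ x ⊗ b ↦ a * s x * b`, which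
carries a monoid structure because the tensor product preserves coequalizers in each variable. This
gives `Mon M` coequalizers. The free monoid `∐ X^⊗n` gives a left adjoint of the forgetful functor;
its counit is a coequalizer preserved by the forgetful functor, hence a regular epimorphism, and the
adjoint triangle theorem, applied to the constant-diagram functors, lifts the colimits of `M` to
`Mon M`. Finally, dividing each value of a functor by the commutation relations imposed by
orthogonality is a reflection of `C ⥤ Mon M` onto the `⊥`-commutative functors.
-/

section RegularEpiCounit

variable {D E : Type*} [Category* D] [Category* E] {F : E ⥤ D} {U : D ⥤ E}

/-- Over a diagram of shape `J` the counit is again a regular epimorphism, since coequalizers of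
functors are computed pointwise. -/
noncomputable def regularEpiCounitWhiskerRight (adj : F ⊣ U)
    (h : ∀ A : D, RegularEpi (adj.counit.app A)) {J : Type*} [Category* J] (X : J ⥤ D) :
    RegularEpi ((adj.whiskerRight J).counit.app X) where
  W := X ⋙ (U ⋙ F) ⋙ U ⋙ F
  left := Functor.whiskerLeft X (Functor.whiskerRight adj.counit (U ⋙ F))
  right := Functor.whiskerLeft X (Functor.whiskerLeft (U ⋙ F) adj.counit)
  w := by
    ext j
    simp
  isColimit := evaluationJointlyReflectsColimits _ fun j =>
    (isColimitMapCoconeCoforkEquiv ((evaluation J D).obj j) _).symm <| by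
      simpa using LiftLeftAdjoint.counitCoequalises adj h (X.obj j)

theorem hasColimitsOfShape_of_regularEpi_counit (adj : F ⊣ U)
    (h : ∀ A : D, RegularEpi (adj.counit.app A)) (J : Type*) [Category* J]
    [HasColimitsOfShape J E] [HasReflexiveCoequalizers D] : HasColimitsOfShape J D := by
  have := adj.isRightAdjoint
  have : (Functor.const J : E ⥤ _).IsRightAdjoint :=
    hasColimitsOfShape_iff_isRightAdjoint_const.mp inferInstance
  have := Functor.isRightAdjoint_of_iso (Functor.compConstIso J U)
  rw [hasColimitsOfShape_iff_isRightAdjoint_const]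
  exact isRightAdjoint_triangle_lift _ (adj.whiskerRight J) (regularEpiCounitWhiskerRight adj h)

/-- The split coequalizer exhibiting `U A` as a quotient of `U F U A`. -/
def isSplitCoequalizerCounit (adj : F ⊣ U) (A : D) :
    IsSplitCoequalizer (U.map (F.map (U.map (adj.counit.app A))))
      (U.map (adj.counit.app (F.obj (U.obj A)))) (U.map (adj.counit.app A)) where
  rightSection := adj.unit.app (U.obj A)
  leftSection := adj.unit.app (U.obj (F.obj (U.obj A)))
  condition := by
    rw [← U.map_comp, ← U.map_comp]
    exact congrArg U.map (adj.counit_naturality (adj.counit.app A))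
  rightSection_π := adj.right_triangle_components A
  leftSection_bottom := adj.right_triangle_components (F.obj (U.obj A))
  leftSection_top := adj.unit_naturality (U.map (adj.counit.app A))

end RegularEpiCounit

section Forget

open MonObj

variable {M : Type*} [Category* M] [MonoidalCategory M] {A B Q : M} [MonObj A] [MonObj B] [MonObj Q]

lemma isMonHom_of_epi_comp (e : A ⟶ Q) [IsMonHom e] [Epi (e ⊗ₘ e)] (f : Q ⟶ B)
    (h : IsMonHom (e ≫ f)) : IsMonHom f where
  one_hom := by rw [← IsMonHom.one_hom e, Category.assoc, IsMonHom.one_hom]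
  mul_hom := by
    rw [← cancel_epi (e ⊗ₘ e), ← IsMonHom.mul_hom_assoc, IsMonHom.mul_hom,
      tensorHom_comp_tensorHom_assoc]

noncomputable def isColimitCoforkOfIsSplitCoequalizer {R A Q : Mon M} {f g : R ⟶ A} {e : A ⟶ Q}
    (t : IsSplitCoequalizer f.hom g.hom e.hom) :
    IsColimit (Cofork.ofπ e (Mon.Hom.ext t.condition)) := by
  have he : Epi e.hom := (SplitEpi.mk _ t.rightSection_π).epi
  have : Epi (e.hom ⊗ₘ e.hom) := (SplitEpi.mk (t.rightSection ⊗ₘ t.rightSection) (by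
    rw [tensorHom_comp_tensorHom, t.rightSection_π, id_tensorHom_id])).epi
  refine Cofork.IsColimit.mk' _ fun s => ?_
  obtain ⟨d, hd : e.hom ≫ d = s.π.hom⟩ :=
    Cofork.IsColimit.desc' t.isCoequalizer s.π.hom congr(($s.condition).hom)
  have := isMonHom_of_epi_comp e.hom d (by rw [hd]; infer_instance)
  exact ⟨⟨d⟩, Mon.Hom.ext hd, fun hm => Mon.Hom.ext <|
    he.left_cancellation _ _ (congr(($hm).hom).trans hd.symm)⟩

noncomputable def regularEpiCounitForget {F : M ⥤ Mon M} (adj : F ⊣ Mon.forget M) (A : Mon M) :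
    RegularEpi (adj.counit.app A) where
  W := F.obj (F.obj A.X).X
  left := F.map (adj.counit.app A).hom
  right := adj.counit.app (F.obj A.X)
  w := adj.counit_naturality (adj.counit.app A)
  isColimit := isColimitCoforkOfIsSplitCoequalizer (isSplitCoequalizerCounit adj A)

end Forget

section Epi

open MonObj

variable {M : Type*} [Category* M] [MonoidalCategory M]

instance epi_whiskerLeft (Z : M) [(tensorLeft Z).PreservesEpimorphisms] {X Y : M} (f : X ⟶ Y)
    [Epi f] : Epi (Z ◁ f) :=
  inferInstanceAs (Epi ((tensorLeft Z).map f))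

instance epi_whiskerRight (Z : M) [(tensorRight Z).PreservesEpimorphisms] {X Y : M} (f : X ⟶ Y)
    [Epi f] : Epi (f ▷ Z) :=
  inferInstanceAs (Epi ((tensorRight Z).map f))

instance epi_tensorHom {X Y X' Y' : M} [(tensorRight X').PreservesEpimorphisms]
    [(tensorLeft Y).PreservesEpimorphisms] (f : X ⟶ Y) (g : X' ⟶ Y') [Epi f] [Epi g] :
    Epi (f ⊗ₘ g) := by
  rw [MonoidalCategory.tensorHom_def]; infer_instance

variable [∀ Z : M, (tensorLeft Z).PreservesEpimorphisms]
  [∀ Z : M, (tensorRight Z).PreservesEpimorphisms]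

/-- A monoid structure descends along an epimorphism as soon as the multiplication does. -/
@[reducible]
def monObjOfEpi {A Q : M} [MonObj A] (π : A ⟶ Q) [Epi π] (m : Q ⊗ Q ⟶ Q)
    (hm : (π ⊗ₘ π) ≫ m = μ ≫ π) : MonObj Q where
  one := η ≫ π
  mul := m
  one_mul := by
    have h : 𝟙_ M ◁ π ≫ (η ≫ π) ▷ Q = η ▷ A ≫ (π ⊗ₘ π) := by
      simp [← id_tensorHom, ← tensorHom_id]
    rw [← cancel_epi (_ ◁ π), reassoc_of% h, hm, MonObj.one_mul_assoc, leftUnitor_naturality]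
  mul_one := by
    have h : π ▷ 𝟙_ M ≫ Q ◁ (η ≫ π) = A ◁ η ≫ (π ⊗ₘ π) := by
      simp [← id_tensorHom, ← tensorHom_id]
    rw [← cancel_epi (π ▷ _), reassoc_of% h, hm, MonObj.mul_one_assoc, rightUnitor_naturality]
  mul_assoc := by
    have h₁ : ((π ⊗ₘ π) ⊗ₘ π) ≫ m ▷ Q = μ ▷ A ≫ (π ⊗ₘ π) := by
      simp only [← tensorHom_id, tensorHom_comp_tensorHom, hm, Category.comp_id, Category.id_comp]
    have h₂ : (π ⊗ₘ π ⊗ₘ π) ≫ Q ◁ m = A ◁ μ ≫ (π ⊗ₘ π) := by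
      simp only [← id_tensorHom, tensorHom_comp_tensorHom, hm, Category.comp_id, Category.id_comp]
    rw [← cancel_epi ((π ⊗ₘ π) ⊗ₘ π), reassoc_of% h₁, associator_naturality_assoc,
      reassoc_of% h₂, hm, MonObj.mul_assoc_assoc]

end Epi

section Sandwich

open MonObj

variable {M : Type*} [Category* M] [MonoidalCategory M] {A X : M} [MonObj A] (r : X ⟶ A)

/-- The extension `a ⊗ x ⊗ b ↦ a * r x * b` of `r : X ⟶ A` to a morphism of `A`-bimodules. Its
coequalizer with the extension of `s : X ⟶ A` is the quotient of `A` by the two-sided congruence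
generated by `r` and `s`. -/
def sandwich : A ⊗ X ⊗ A ⟶ A :=
  A ◁ (r ▷ A ≫ μ) ≫ μ

lemma sandwich_comp {B : M} [MonObj B] (f : A ⟶ B) [IsMonHom f] :
    sandwich r ≫ f = (f ⊗ₘ (r ≫ f) ⊗ₘ f) ≫ B ◁ μ ≫ μ := by
  simp only [sandwich, Category.assoc, IsMonHom.mul_hom, ← tensorHom_id, ← id_tensorHom,
    tensorHom_comp_tensorHom_assoc, Category.id_comp, Category.comp_id]

lemma whiskerLeft_sandwich_mul :
    A ◁ sandwich r ≫ μ = (α_ A A (X ⊗ A)).inv ≫ μ ▷ (X ⊗ A) ≫ sandwich r := by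
  rw [sandwich, ← whisker_exchange_assoc]
  simp

lemma sandwich_whiskerRight_mul :
    sandwich r ▷ A ≫ μ = (α_ A (X ⊗ A) A).hom ≫ A ◁ ((α_ X A A).hom ≫ X ◁ μ) ≫ sandwich r := by
  have h : (r ▷ A ≫ μ) ▷ A ≫ μ = (α_ X A A).hom ≫ X ◁ μ ≫ r ▷ A ≫ μ := by
    rw [whisker_exchange_assoc]; simp
  rw [sandwich, comp_whiskerRight, Category.assoc, MonObj.mul_assoc,
    associator_naturality_middle_assoc, ← MonoidalCategory.whiskerLeft_comp_assoc, h]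
  simp

lemma one_sandwich_one :
    (λ_ X).inv ≫ η[A] ▷ X ≫ A ◁ ((ρ_ X).inv ≫ X ◁ η[A]) ≫ sandwich r = r := by
  rw [sandwich, ← MonoidalCategory.whiskerLeft_comp_assoc, Category.assoc, whisker_exchange_assoc,
    MonObj.mul_one, rightUnitor_naturality, Iso.inv_hom_id_assoc, ← whisker_exchange_assoc,
    MonObj.one_mul, leftUnitor_naturality, Iso.inv_hom_id_assoc]

variable {r} {s : X ⟶ A}

lemma sandwich_comp_eq {B : M} [MonObj B] (f : A ⟶ B) [IsMonHom f] (h : r ≫ f = s ≫ f) :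
    sandwich r ≫ f = sandwich s ≫ f := by
  rw [sandwich_comp, sandwich_comp, h]

lemma comp_eq_of_sandwich_comp_eq {Y : M} (f : A ⟶ Y) (h : sandwich r ≫ f = sandwich s ≫ f) :
    r ≫ f = s ≫ f := by
  rw [← one_sandwich_one r, ← one_sandwich_one s]
  simp only [Category.assoc, h]

end Sandwich

section Quotient

open MonObj

variable {M : Type*} [Category* M] [MonoidalCategory M] [HasCoequalizers M]
  [∀ Z : M, PreservesFiniteColimits (tensorLeft Z)]
  [∀ Z : M, PreservesFiniteColimits (tensorRight Z)]

lemma exists_coequalizer_tensorHom_comp_eq {R A Y : M} (f g : R ⟶ A) (k : A ⊗ A ⟶ Y)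
    (hl : A ◁ f ≫ k = A ◁ g ≫ k) (hr : f ▷ A ≫ k = g ▷ A ≫ k) :
    ∃ m : coequalizer f g ⊗ coequalizer f g ⟶ Y,
      (coequalizer.π f g ⊗ₘ coequalizer.π f g) ≫ m = k := by
  obtain ⟨l, hl : A ◁ coequalizer.π f g ≫ l = k⟩ := Cofork.IsColimit.desc'
    (isColimitOfHasCoequalizerOfPreservesColimit (tensorLeft A) f g) k hl
  have hlr : f ▷ coequalizer f g ≫ l = g ▷ coequalizer f g ≫ l := by
    rw [← cancel_epi (_ ◁ coequalizer.π f g), whisker_exchange_assoc, whisker_exchange_assoc, hl,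
      hr]
  obtain ⟨m, hm : coequalizer.π f g ▷ _ ≫ m = l⟩ := Cofork.IsColimit.desc'
    (isColimitOfHasCoequalizerOfPreservesColimit (tensorRight (coequalizer f g)) f g) l hlr
  exact ⟨m, by rw [MonoidalCategory.tensorHom_def', Category.assoc, hm, hl]⟩

lemma exists_mul_coequalizer_sandwich {A X : M} [MonObj A] (r s : X ⟶ A) :
    ∃ m : coequalizer (sandwich r) (sandwich s) ⊗ coequalizer (sandwich r) (sandwich s) ⟶
        coequalizer (sandwich r) (sandwich s),
      (coequalizer.π (sandwich r) (sandwich s) ⊗ₘ coequalizer.π (sandwich r) (sandwich s)) ≫ m =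
        μ ≫ coequalizer.π (sandwich r) (sandwich s) := by
  have h := coequalizer.condition (sandwich r) (sandwich s)
  apply exists_coequalizer_tensorHom_comp_eq
  · simp only [reassoc_of% whiskerLeft_sandwich_mul, h]
  · simp only [reassoc_of% sandwich_whiskerRight_mul, h]

/-- The quotient of a monoid object by the two-sided congruence generated by a parallel pair of
morphisms of the underlying category. -/
noncomputable def MonQuotient {A : Mon M} {X : M} (r s : X ⟶ A.X) : Mon M where
  X := coequalizer (sandwich r) (sandwich s)
  mon := monObjOfEpi (coequalizer.π _ _) _ (exists_mul_coequalizer_sandwich r s).choose_spec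

namespace MonQuotient

variable {A : Mon M} {X : M} (r s : X ⟶ A.X)

/-- The projection of `A` onto its quotient. -/
noncomputable def π : A ⟶ MonQuotient r s where
  hom := coequalizer.π (sandwich r) (sandwich s)
  isMonHom_hom := ⟨rfl, (exists_mul_coequalizer_sandwich r s).choose_spec.symm⟩

instance : Epi (π r s).hom :=
  inferInstanceAs (Epi (coequalizer.π (sandwich r) (sandwich s)))

lemma condition : r ≫ (π r s).hom = s ≫ (π r s).hom :=
  comp_eq_of_sandwich_comp_eq _ (coequalizer.condition (sandwich r) (sandwich s))

variable {r s}

lemma hom_ext {B : Mon M} {g k : MonQuotient r s ⟶ B} (h : π r s ≫ g = π r s ≫ k) : g = k := by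
  ext
  rw [← cancel_epi (π r s).hom]
  exact congr(($h).hom)

lemma exists_π_comp_eq {B : Mon M} (f : A ⟶ B) (h : r ≫ f.hom = s ≫ f.hom) :
    ∃ g : MonQuotient r s ⟶ B, π r s ≫ g = f := by
  obtain ⟨g, hg : (π r s).hom ≫ g = f.hom⟩ :=
    Cofork.IsColimit.desc' (coequalizerIsCoequalizer _ _) f.hom (sandwich_comp_eq f.hom h)
  have := isMonHom_of_epi_comp (π r s).hom g (by rw [hg]; infer_instance)
  exact ⟨⟨g⟩, Mon.Hom.ext hg⟩

/-- The morphism of monoids out of the quotient induced by `f`. -/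
noncomputable def desc {B : Mon M} (f : A ⟶ B) (h : r ≫ f.hom = s ≫ f.hom) :
    MonQuotient r s ⟶ B :=
  (exists_π_comp_eq f h).choose

lemma π_desc {B : Mon M} (f : A ⟶ B) (h : r ≫ f.hom = s ≫ f.hom) : π r s ≫ desc f h = f :=
  (exists_π_comp_eq f h).choose_spec

end MonQuotient

instance hasCoequalizers_mon : HasCoequalizers (Mon M) := by
  have {R A : Mon M} {f g : R ⟶ A} : HasColimit (parallelPair f g) :=
    ⟨_, Cofork.IsColimit.mk (Cofork.ofπ (MonQuotient.π f.hom g.hom)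
        (Mon.Hom.ext (MonQuotient.condition f.hom g.hom)))
      (fun s => MonQuotient.desc s.π congr(($s.condition).hom))
      (fun _ => MonQuotient.π_desc _ _)
      fun _ _ hm => MonQuotient.hom_ext (hm.trans (MonQuotient.π_desc _ _).symm)⟩
  exact hasCoequalizers_of_hasColimit_parallelPair _

end Quotient

section FreeMonoid

open MonObj

variable {M : Type*} [Category* M] [MonoidalCategory M] [HasColimitsOfShape (Discrete ℕ) M]

/-- The `n`-fold tensor power, bracketed to the left. -/
def tensorPow (X : M) : ℕ → M
  | 0 => 𝟙_ M
  | n + 1 => tensorPow X n ⊗ X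

/-- The free monoid on `X`, an object of words in the letters `X`. -/
noncomputable def wordObj (X : M) : M := ∐ tensorPow X

namespace wordObj

variable {X Y Z : M}

variable (X) in
/-- The inclusion of the words of length `n`. -/
noncomputable def ofLength (n : ℕ) : tensorPow X n ⟶ wordObj X := Sigma.ι (tensorPow X) n

section Preserves

variable (G : M ⥤ M) [PreservesColimitsOfShape (Discrete ℕ) G]

lemma hom_ext_of_length {f g : G.obj (wordObj X) ⟶ Y}
    (h : ∀ n, G.map (ofLength X n) ≫ f = G.map (ofLength X n) ≫ g) : f = g :=
  Cofan.IsColimit.hom_ext (isColimitOfHasCoproductOfPreservesColimit G (tensorPow X)) f g h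

lemma exists_desc (f : ∀ n, G.obj (tensorPow X n) ⟶ Y) :
    ∃ l : G.obj (wordObj X) ⟶ Y, ∀ n, G.map (ofLength X n) ≫ l = f n :=
  ⟨_, Cofan.IsColimit.fac (isColimitOfHasCoproductOfPreservesColimit G (tensorPow X)) f⟩

end Preserves

variable (X) in
/-- The empty word. -/
noncomputable def nil : 𝟙_ M ⟶ wordObj X := ofLength X 0

variable [∀ Z : M, PreservesColimitsOfShape (Discrete ℕ) (tensorRight Z)]

variable (X) in
/-- Appending a letter to a word. -/
noncomputable def snoc : wordObj X ⊗ X ⟶ wordObj X :=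
  (exists_desc (tensorRight X) fun n => ofLength X (n + 1)).choose

lemma ofLength_whiskerRight_snoc (n : ℕ) : ofLength X n ▷ X ≫ snoc X = ofLength X (n + 1) :=
  (exists_desc (tensorRight X) fun n => ofLength X (n + 1)).choose_spec n

lemma ofLength_succ_comp {h : Z ⊗ wordObj X ⟶ Y} (a : Y ⊗ X ⟶ Y) (n : ℕ)
    (snoc : Z ◁ snoc X ≫ h = (α_ Z (wordObj X) X).inv ≫ h ▷ X ≫ a) :
    Z ◁ ofLength X (n + 1) ≫ h =
      (α_ Z (tensorPow X n) X).inv ≫ (Z ◁ ofLength X n ≫ h) ▷ X ≫ a := by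
  rw [comp_whiskerRight_assoc, ← associator_inv_naturality_middle_assoc, ← snoc,
    ← MonoidalCategory.whiskerLeft_comp_assoc, ofLength_whiskerRight_snoc]
  rfl

variable [∀ Z : M, PreservesColimitsOfShape (Discrete ℕ) (tensorLeft Z)]

lemma hom_ext {h k : Z ⊗ wordObj X ⟶ Y} (a : Y ⊗ X ⟶ Y)
    (nil : Z ◁ nil X ≫ h = Z ◁ nil X ≫ k)
    (snoc_h : Z ◁ snoc X ≫ h = (α_ Z (wordObj X) X).inv ≫ h ▷ X ≫ a)
    (snoc_k : Z ◁ snoc X ≫ k = (α_ Z (wordObj X) X).inv ≫ k ▷ X ≫ a) : h = k := by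
  refine hom_ext_of_length (tensorLeft Z) fun n => ?_
  change Z ◁ ofLength X n ≫ h = Z ◁ ofLength X n ≫ k
  induction n with
  | zero => exact nil
  | succ n ih =>
    exact (ofLength_succ_comp a n snoc_h).trans
      (.trans (by rw [ih]) (ofLength_succ_comp a n snoc_k).symm)

lemma hom_ext_unit {h k : wordObj X ⟶ Y} (a : Y ⊗ X ⟶ Y) (nil : nil X ≫ h = nil X ≫ k)
    (snoc_h : snoc X ≫ h = h ▷ X ≫ a) (snoc_k : snoc X ≫ k = k ▷ X ≫ a) : h = k := by
  rw [← cancel_epi (λ_ (wordObj X)).hom]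
  apply hom_ext a
  · simp only [leftUnitor_naturality_assoc, nil]
  · simp [snoc_h]
  · simp [snoc_k]

lemma exists_fold (z : Z ⟶ Y) (a : Y ⊗ X ⟶ Y) :
    ∃ h : Z ⊗ wordObj X ⟶ Y, Z ◁ nil X ≫ h = (ρ_ Z).hom ≫ z ∧
      Z ◁ snoc X ≫ h = (α_ Z (wordObj X) X).inv ≫ h ▷ X ≫ a := by
  let f (n : ℕ) : Z ⊗ tensorPow X n ⟶ Y :=
    Nat.rec ((ρ_ Z).hom ≫ z) (fun n g => (α_ Z (tensorPow X n) X).inv ≫ g ▷ X ≫ a) n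
  obtain ⟨h, hh : ∀ n, Z ◁ ofLength X n ≫ h = f n⟩ := exists_desc (tensorLeft Z) f
  refine ⟨h, hh 0, hom_ext_of_length (tensorRight X ⋙ tensorLeft Z) fun n => ?_⟩
  calc
    Z ◁ ofLength X n ▷ X ≫ Z ◁ snoc X ≫ h = (α_ Z (tensorPow X n) X).inv ≫ f n ▷ X ≫ a := by
      rw [← MonoidalCategory.whiskerLeft_comp_assoc, ofLength_whiskerRight_snoc]
      exact hh (n + 1)
    _ = Z ◁ ofLength X n ▷ X ≫ (α_ Z (wordObj X) X).inv ≫ h ▷ X ≫ a := by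
      rw [← hh, comp_whiskerRight_assoc, associator_inv_naturality_middle_assoc]

/-- The morphism out of `Z ⊗ wordObj X` defined by recursion on words, with value `z` on the empty
word and updated by `a` whenever a letter is appended. -/
noncomputable def fold (z : Z ⟶ Y) (a : Y ⊗ X ⟶ Y) : Z ⊗ wordObj X ⟶ Y :=
  (exists_fold z a).choose

lemma nil_fold (z : Z ⟶ Y) (a : Y ⊗ X ⟶ Y) : Z ◁ nil X ≫ fold z a = (ρ_ Z).hom ≫ z :=
  (exists_fold z a).choose_spec.1

lemma snoc_fold (z : Z ⟶ Y) (a : Y ⊗ X ⟶ Y) :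
    Z ◁ snoc X ≫ fold z a = (α_ Z (wordObj X) X).inv ≫ fold z a ▷ X ≫ a :=
  (exists_fold z a).choose_spec.2

variable (X) in
/-- Concatenation of words. -/
noncomputable def append : wordObj X ⊗ wordObj X ⟶ wordObj X := fold (𝟙 _) (snoc X)

lemma append_nil : wordObj X ◁ nil X ≫ append X = (ρ_ _).hom :=
  (nil_fold _ _).trans (Category.comp_id _)

lemma append_snoc :
    wordObj X ◁ snoc X ≫ append X = (α_ _ _ _).inv ≫ append X ▷ X ≫ snoc X :=
  snoc_fold _ _

noncomputable instance : MonObj (wordObj X) where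
  one := nil X
  mul := append X
  one_mul := by
    apply hom_ext (snoc X)
    · rw [whisker_exchange_assoc, append_nil, rightUnitor_naturality, leftUnitor_naturality,
        unitors_equal]
    · rw [whisker_exchange_assoc, append_snoc]
      simp
    · simp
  mul_one := append_nil
  mul_assoc := by
    apply hom_ext (snoc X)
    · rw [whisker_exchange_assoc, append_nil, rightUnitor_naturality,
        associator_naturality_right_assoc, ← MonoidalCategory.whiskerLeft_comp_assoc, append_nil]
      simp
    · rw [whisker_exchange_assoc, append_snoc]
      simp
    · rw [associator_naturality_right_assoc, ← MonoidalCategory.whiskerLeft_comp_assoc,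
        append_snoc]
      simp [append_snoc]

lemma mul_nil : wordObj X ◁ nil X ≫ μ = (ρ_ _).hom := append_nil

lemma mul_snoc : wordObj X ◁ snoc X ≫ μ = (α_ _ _ _).inv ≫ μ ▷ X ≫ snoc X := append_snoc

variable (X) in
/-- The inclusion of the one-letter words. -/
noncomputable def singleton : X ⟶ wordObj X :=
  (λ_ X).inv ≫ nil X ▷ X ≫ snoc X

lemma mul_singleton : wordObj X ◁ singleton X ≫ μ = snoc X := by
  simp only [singleton, MonoidalCategory.whiskerLeft_comp, Category.assoc, mul_snoc,
    associator_inv_naturality_middle_assoc]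
  rw [← comp_whiskerRight_assoc, mul_nil]
  simp

variable {B : M} [MonObj B]

lemma snoc_comp (g : wordObj X ⟶ B) [IsMonHom g] :
    snoc X ≫ g = g ▷ X ≫ B ◁ (singleton X ≫ g) ≫ μ := by
  rw [← mul_singleton, Category.assoc, IsMonHom.mul_hom]
  simp [MonoidalCategory.tensorHom_def, whisker_exchange_assoc]

lemma monHom_ext {g k : wordObj X ⟶ B} [IsMonHom g] [IsMonHom k]
    (h : singleton X ≫ g = singleton X ≫ k) : g = k := by
  have one_comp (f : wordObj X ⟶ B) [IsMonHom f] : nil X ≫ f = η := IsMonHom.one_hom f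
  apply hom_ext_unit (B ◁ (singleton X ≫ g) ≫ μ)
  · rw [one_comp, one_comp]
  · rw [snoc_comp]
  · rw [h, snoc_comp]

/-- The morphism of monoids extending `f`. -/
noncomputable def lift (f : X ⟶ B) : wordObj X ⟶ B :=
  (λ_ _).inv ≫ fold η (B ◁ f ≫ μ)

lemma nil_lift (f : X ⟶ B) : nil X ≫ lift f = η := by
  rw [lift, leftUnitor_inv_naturality_assoc, nil_fold, unitors_inv_equal, Iso.inv_hom_id_assoc]

lemma snoc_lift (f : X ⟶ B) : snoc X ≫ lift f = lift f ▷ X ≫ B ◁ f ≫ μ := by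
  rw [lift, leftUnitor_inv_naturality_assoc, snoc_fold]
  simp

lemma singleton_lift (f : X ⟶ B) : singleton X ≫ lift f = f := by
  rw [singleton, Category.assoc, Category.assoc, snoc_lift, ← comp_whiskerRight_assoc, nil_lift,
    ← whisker_exchange_assoc, MonObj.one_mul, leftUnitor_naturality, Iso.inv_hom_id_assoc]

instance (f : X ⟶ B) : IsMonHom (lift f) where
  one_hom := nil_lift f
  mul_hom := by
    apply hom_ext (B ◁ f ≫ μ)
    · rw [reassoc_of% mul_nil, MonoidalCategory.tensorHom_def',
        Category.assoc, ← MonoidalCategory.whiskerLeft_comp_assoc, nil_lift, whisker_exchange_assoc]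
      simp
    · rw [reassoc_of% mul_snoc, snoc_lift]
      simp
    · calc
        _ = (lift f ⊗ₘ lift f ⊗ₘ f) ≫ B ◁ μ ≫ μ := by
          simp only [← id_tensorHom, ← tensorHom_id, tensorHom_comp_tensorHom_assoc, snoc_lift,
            Category.id_comp, Category.comp_id]
        _ = (α_ _ _ _).inv ≫ ((lift f ⊗ₘ lift f) ⊗ₘ f) ≫ μ ▷ B ≫ μ := by
          rw [MonObj.mul_assoc_flip, associator_inv_naturality_assoc]
        _ = _ := by
          simp only [← id_tensorHom, ← tensorHom_id, tensorHom_comp_tensorHom_assoc,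
            Category.id_comp, Category.comp_id]

end wordObj

end FreeMonoid

section Cocomplete

theorem isRightAdjoint_of_exists_universal {D E : Type*} [Category* D] [Category* E] {U : D ⥤ E}
    (h : ∀ X : E, ∃ (A : D) (i : X ⟶ U.obj A),
      ∀ (B : D) (f : X ⟶ U.obj B), ∃! g : A ⟶ B, i ≫ U.map g = f) :
    U.IsRightAdjoint := by
  rw [isRightAdjoint_iff_hasInitial_structuredArrow]
  intro X
  obtain ⟨A, i, hi⟩ := h X
  choose g hg hg_unique using hi
  exact IsInitial.hasInitial <| IsInitial.ofUniqueHom (X := StructuredArrow.mk i)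
    (fun T => StructuredArrow.homMk (g T.right T.hom) (hg T.right T.hom))
    fun T m => StructuredArrow.ext _ _ (hg_unique T.right T.hom m.right (StructuredArrow.w m))

variable (M : Type*) [Category* M] [MonoidalCategory M] [HasColimitsOfShape (Discrete ℕ) M]
  [∀ Z : M, PreservesColimitsOfShape (Discrete ℕ) (tensorLeft Z)]
  [∀ Z : M, PreservesColimitsOfShape (Discrete ℕ) (tensorRight Z)]

theorem isRightAdjoint_mon_forget : (Mon.forget M).IsRightAdjoint :=
  isRightAdjoint_of_exists_universal fun X => ⟨Mon.mk (wordObj X), wordObj.singleton X,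
    fun B (f : X ⟶ B.X) => ⟨⟨wordObj.lift f⟩, wordObj.singleton_lift f,
      fun _ hg => Mon.Hom.ext <| wordObj.monHom_ext (hg.trans (wordObj.singleton_lift f).symm)⟩⟩

theorem hasColimitsOfShape_mon (J : Type*) [Category* J] [HasCoequalizers M]
    [∀ Z : M, PreservesFiniteColimits (tensorLeft Z)]
    [∀ Z : M, PreservesFiniteColimits (tensorRight Z)]
    [HasColimitsOfShape J M] : HasColimitsOfShape J (Mon M) :=
  have := isRightAdjoint_mon_forget M
  hasColimitsOfShape_of_regularEpi_counit (Adjunction.ofIsRightAdjoint (Mon.forget M))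
    (regularEpiCounitForget _) J

end Cocomplete

section Commute

open MonObj

variable {M : Type*} [Category* M] [MonoidalCategory M] [BraidedCategory M] {A X Y : M} [MonObj A]

/-- Two morphisms into a monoid object commute if multiplying their values in either order gives
the same result. -/
def MorphismsCommute (a : X ⟶ A) (b : Y ⟶ A) : Prop :=
  (a ⊗ₘ b) ≫ μ = (a ⊗ₘ b) ≫ (β_ A A).hom ≫ μ

namespace MorphismsCommute

lemma comp_iff {B : M} [MonObj B] (a : X ⟶ A) (b : Y ⟶ A) (f : A ⟶ B) [IsMonHom f] :
    MorphismsCommute (a ≫ f) (b ≫ f) ↔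
      ((a ⊗ₘ b) ≫ μ) ≫ f = ((a ⊗ₘ b) ≫ (β_ A A).hom ≫ μ) ≫ f := by
  simp only [MorphismsCommute, Category.assoc, IsMonHom.mul_hom, ← tensorHom_comp_tensorHom,
    BraidedCategory.braiding_naturality_assoc]

variable {a : X ⟶ A} {b : Y ⟶ A} {X' Y' : M} (x : X' ⟶ X) (y : Y' ⟶ Y)

lemma precomp (h : MorphismsCommute a b) : MorphismsCommute (x ≫ a) (y ≫ b) := by
  simpa only [MorphismsCommute, tensorHom_comp_tensorHom_assoc] using (x ⊗ₘ y) ≫= h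

lemma of_precomp [Epi (x ⊗ₘ y)] (h : MorphismsCommute (x ≫ a) (y ≫ b)) :
    MorphismsCommute a b := by
  rw [MorphismsCommute, ← cancel_epi (x ⊗ₘ y)]
  simpa only [MorphismsCommute, tensorHom_comp_tensorHom_assoc] using h

end MorphismsCommute

end Commute

section Limits

variable {C : Type w} [SmallCategory C] (O : OrthogonalityRelation C)
  (M : Type u) [Category.{v} M] [MonoidalCategory M] [SymmetricCategory M]

theorem isClosedUnderLimitsOfShape_isPerpCommutative (J : Type*) [Category* J]
    [HasLimitsOfShape J M] : (IsPerpCommutative O M).IsClosedUnderLimitsOfShape J where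
  limitsOfShape_le := by
    rintro A ⟨p⟩ c₁ c₂ c f₁ f₂ h
    have hc := isLimitOfPreserves ((evaluation C (Mon M)).obj c ⋙ Mon.forget M) p.isLimit
    refine hc.hom_ext fun j => ?_
    have nat {d : C} (f : d ⟶ c) :
        (A.map f).hom ≫ ((p.π.app j).app c).hom =
          ((p.π.app j).app d).hom ≫ ((p.diag.obj j).map f).hom :=
      congr(($((p.π.app j).naturality f)).hom)
    refine (MorphismsCommute.comp_iff _ _ ((p.π.app j).app c).hom).1 ?_
    rw [nat, nat]
    exact MorphismsCommute.precomp _ _ (p.prop_diag_obj j f₁ f₂ h)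

end Limits

section Reflection

lemma sigmaDesc_comp_eq_iff {E I : Type*} [Category* E] {X : I → E} [HasCoproduct X] {A B : E}
    (r s : ∀ i, X i ⟶ A) (f : A ⟶ B) :
    Sigma.desc r ≫ f = Sigma.desc s ≫ f ↔ ∀ i, r i ≫ f = s i ≫ f := by
  refine ⟨fun h i => ?_, fun h => Sigma.hom_ext _ _ fun i => ?_⟩
  · simpa only [Sigma.ι_desc_assoc] using Sigma.ι X i ≫= h
  · simpa only [Sigma.ι_desc_assoc] using h i

open MonObj

variable {C : Type w} [SmallCategory C] (O : OrthogonalityRelation C)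
  {M : Type u} [Category.{v} M] [MonoidalCategory M] [SymmetricCategory M]

/-- A pair of orthogonal morphisms with target `c`, indexing a commutation relation imposed on the
value at `c` of a functor. -/
structure PerpPair (c : C) where
  {c₁ c₂ : C}
  f₁ : c₁ ⟶ c
  f₂ : c₂ ⟶ c
  perp : O.Perp f₁ f₂

variable [HasCoproducts.{w} M] [HasCoequalizers M]
  [∀ Z : M, PreservesFiniteColimits (tensorLeft Z)]
  [∀ Z : M, PreservesFiniteColimits (tensorRight Z)]

/-- The quotient of `A.obj c` by all the commutation relations imposed by orthogonality. -/
noncomputable def PerpQuotient (A : C ⥤ Mon M) (c : C) : Mon M :=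
  MonQuotient
    (Sigma.desc fun p : PerpPair O c => ((A.map p.f₁).hom ⊗ₘ (A.map p.f₂).hom) ≫ μ)
    (Sigma.desc fun p : PerpPair O c => ((A.map p.f₁).hom ⊗ₘ (A.map p.f₂).hom) ≫ (β_ _ _).hom ≫ μ)

namespace PerpQuotient

variable (A : C ⥤ Mon M) {c d : C} {B : Mon M}

/-- The projection of `A.obj c` onto its quotient. -/
noncomputable def π (c : C) : A.obj c ⟶ PerpQuotient O A c := MonQuotient.π _ _

instance (c : C) : Epi (π O A c).hom := inferInstanceAs (Epi (MonQuotient.π _ _).hom)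

variable {O A}

lemma hom_ext {g k : PerpQuotient O A c ⟶ B} (h : π O A c ≫ g = π O A c ≫ k) : g = k :=
  MonQuotient.hom_ext h

variable (O A) in
lemma commute_map_π (p : PerpPair O c) :
    MorphismsCommute (A.map p.f₁ ≫ π O A c).hom (A.map p.f₂ ≫ π O A c).hom :=
  have h := (sigmaDesc_comp_eq_iff _ _ (π O A c).hom).1 (MonQuotient.condition _ _)
  (MorphismsCommute.comp_iff _ _ _).2 (h p)

lemma exists_π_comp_eq (f : A.obj c ⟶ B)
    (hf : ∀ p : PerpPair O c, MorphismsCommute (A.map p.f₁ ≫ f).hom (A.map p.f₂ ≫ f).hom) :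
    ∃ g : PerpQuotient O A c ⟶ B, π O A c ≫ g = f :=
  MonQuotient.exists_π_comp_eq f <|
    (sigmaDesc_comp_eq_iff _ _ _).2 fun p => (MorphismsCommute.comp_iff _ _ _).1 (hf p)

variable (O A) in
lemma exists_π_comp_eq_map_comp_π (g : c ⟶ d) :
    ∃ k : PerpQuotient O A c ⟶ PerpQuotient O A d, π O A c ≫ k = A.map g ≫ π O A d := by
  refine exists_π_comp_eq _ fun p => ?_
  have hp : O.Perp (p.f₁ ≫ g) (p.f₂ ≫ g) := by
    simpa only [Category.id_comp] using O.comp_stable g (𝟙 _) (𝟙 _) p.perp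
  simpa only [Functor.map_comp, Category.assoc] using commute_map_π O A ⟨_, _, hp⟩

variable (O A) in
/-- The morphism of quotients induced by `A.map g`. -/
noncomputable def map (g : c ⟶ d) : PerpQuotient O A c ⟶ PerpQuotient O A d :=
  (exists_π_comp_eq_map_comp_π O A g).choose

lemma π_map (g : c ⟶ d) : π O A c ≫ map O A g = A.map g ≫ π O A d :=
  (exists_π_comp_eq_map_comp_π O A g).choose_spec

end PerpQuotient

/-- The `⊥`-abelianization of a functor, its reflection into the `⊥`-commutative functors. -/
noncomputable def perpAbelianization (A : C ⥤ Mon M) : C ⥤ Mon M where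
  obj := PerpQuotient O A
  map := PerpQuotient.map O A
  map_id c := PerpQuotient.hom_ext <| by
    rw [PerpQuotient.π_map, A.map_id, Category.id_comp, Category.comp_id]
  map_comp g h := PerpQuotient.hom_ext <| by
    rw [PerpQuotient.π_map, reassoc_of% PerpQuotient.π_map g, PerpQuotient.π_map, A.map_comp,
      Category.assoc]

namespace perpAbelianization

variable (A : C ⥤ Mon M)

/-- The unit of the reflection into the `⊥`-commutative functors. -/
noncomputable def π : A ⟶ perpAbelianization O A where
  app := PerpQuotient.π O A
  naturality _ _ g := (PerpQuotient.π_map g).symm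

theorem isPerpCommutative : IsPerpCommutative O M (perpAbelianization O A) := by
  intro c₁ c₂ c f₁ f₂ h
  have nat {d : C} (f : d ⟶ c) :
      (A.map f ≫ PerpQuotient.π O A c).hom =
        (PerpQuotient.π O A d).hom ≫ ((perpAbelianization O A).map f).hom :=
    congr(($((π O A).naturality f)).hom)
  have hcomm := PerpQuotient.commute_map_π O A ⟨f₁, f₂, h⟩
  rw [nat, nat] at hcomm
  exact hcomm.of_precomp _ _

variable {A}

theorem existsUnique_π_comp_eq {B : C ⥤ Mon M} (hB : IsPerpCommutative O M B) (f : A ⟶ B) :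
    ∃! g : perpAbelianization O A ⟶ B, π O A ≫ g = f := by
  have exists_app (c : C) :
      ∃ g : (perpAbelianization O A).obj c ⟶ B.obj c, (π O A).app c ≫ g = f.app c := by
    refine PerpQuotient.exists_π_comp_eq _ fun p => ?_
    rw [f.naturality, f.naturality]
    exact MorphismsCommute.precomp _ _ (hB p.f₁ p.f₂ p.perp)
  choose g hg using exists_app
  refine ⟨⟨g, fun c d h => PerpQuotient.hom_ext ?_⟩, ?_, fun g' hg' => ?_⟩
  · change (π O A).app c ≫ _ = (π O A).app c ≫ _
    rw [← (π O A).naturality_assoc, hg, reassoc_of% hg, f.naturality]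
  · ext c : 2
    exact hg c
  · ext c : 2
    exact PerpQuotient.hom_ext (congr(($hg').app c).trans (hg c).symm)

end perpAbelianization

variable (M) in
theorem isRightAdjoint_isPerpCommutative_ι : (IsPerpCommutative O M).ι.IsRightAdjoint :=
  isRightAdjoint_of_exists_universal fun A =>
    ⟨⟨_, perpAbelianization.isPerpCommutative O A⟩, perpAbelianization.π O A, fun B f =>
      have ⟨g, hg, hg_unique⟩ := perpAbelianization.existsUnique_π_comp_eq O B.property f
      ⟨⟨g⟩, hg, fun k hk => ObjectProperty.hom_ext _ (hg_unique k.hom hk)⟩⟩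

end Reflection

theorem proposition2p7_general {C : Type w} [SmallCategory C] (O : OrthogonalityRelation C)
    (M : Type u) [Category.{v} M] [MonoidalCategory M] [SymmetricCategory M]
    [∀ X : M, PreservesFiniteColimits (tensorLeft X)]
    [∀ X : M, PreservesColimitsOfShape (Discrete ℕ) (tensorLeft X)]
    [HasLimitsOfSize.{w, w} M] [HasColimitsOfSize.{w, w} M] :
    HasLimitsOfSize.{w, w} (QFT O M) ∧ HasColimitsOfSize.{w, w} (QFT O M) := by
  constructor
  · exact ⟨fun J _ =>
      have := isClosedUnderLimitsOfShape_isPerpCommutative O M J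
      hasLimitsOfShape_of_closedUnderLimits J _⟩
  · have := hasColimitsOfSizeShrink.{0, 0, w, w} M
    have (X : M) : PreservesFiniteColimits (tensorRight X) :=
      preservesFiniteColimits_of_natIso (BraidedCategory.tensorLeftIsoTensorRight X)
    have (X : M) : PreservesColimitsOfShape (Discrete ℕ) (tensorRight X) :=
      preservesColimitsOfShape_of_natIso (BraidedCategory.tensorLeftIsoTensorRight X)
    have : HasColimitsOfSize.{w, w} (Mon M) := ⟨fun J _ => hasColimitsOfShape_mon M J⟩
    have := isRightAdjoint_isPerpCommutative_ι O M
    let _ : Reflective (IsPerpCommutative O M).ι := ⟨_, Adjunction.ofIsRightAdjoint _⟩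
    exact hasColimits_of_reflective (IsPerpCommutative O M).ι

theorem proposition2p7 {C : Type w} [SmallCategory C] (O : OrthogonalityRelation C)
    (M : Type u) [Category.{v} M] [MonoidalCategory M] [SymmetricCategory M] [MonoidalClosed M]
    [HasLimitsOfSize.{w, w} M] [HasColimitsOfSize.{w, w} M] :
    HasLimitsOfSize.{w, w} (QFT O M) ∧ HasColimitsOfSize.{w, w} (QFT O M) :=
  proposition2p7_general O M
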